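/- **Setting.** Let $n\ge 2$. A computational DAG (CDAG) $G$ of the family $\mathcal G(n)$ is built as follows. For $1\le i\le n$ there is an input vertex $v_{i,i}$. For each $1\le i<j\le n$ there is a binary tree with $j-i$ leaves (every vertex has at most two children), of arbitrary shape and with its leaves numbered $0,\dots,j-i-1$ in an arbitrary way, with all edges directed towards its root, which is denoted $v_{i,j}$; these trees are pairwise vertex-disjoint, and the $k$-th leaf of the tree of $(i,j)$ has exactly the two predecessors $v_{i,i+k}$ and $v_{i+k+1,j}$. A CDAG is evaluated on a machine with a cache of $M$ words and an unbounded slow memory, one word per value. At the beginning the cache is empty and the slow memory holds exactly the input values; at the end the output value (that of $v_{1,n}$) must be in the slow memory. A non-input value can be computed only when the values of all its predecessors are in the cache, and it is then placed in the cache; values may be discarded from the cache freely. One I/O operation (a read or a write) moves up to $B$ words lying in a block of $B$ consecutive slow-memory locations from the slow memory to the cache, or from the cache to the slow memory. **Theorem 1.** Let $n\ge 2$, $M\ge 1$, $B\ge 1$ be integers and let $G\in\mathcal G(n)$. Every schedule that evaluates $G$ with cache size $M$ and block size $B$ and computes no value more than once executes at least $$\max\left\{\frac{n^3-n}{16\sqrt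 M}-\frac{n(n+1)}{2}-3M,\; n\right\}\cdot\frac1B$$ I/O operations. Consequently there are absolute constants $c,K>0$ such that, whenever $M\le c\,n^2$, every such schedule executes at least $K\,\dfrac{n^3}{\sqrt M\,B}$ I/O operations. -/

import Mathlib

/-! ### The machine: a cache of `M` words, an addressed slow memory, blocks of `B` words -/

/-- An input vertex of a computational DAG: a vertex without predecessors
(`G.Adj u v` means that the value of `u` is an operand of the operation computing `v`). -/
def IsInputVertex {V : Type*} (G : Digraph V) (v : V) : Prop := ∀ u, ¬ G.Adj u v

/-- An output vertex of a computational DAG: a vertex without successors. -/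
def IsOutputVertex {V : Type*} (G : Digraph V) (v : V) : Prop := ∀ w, ¬ G.Adj v w

/-- The contents of the two memory levels: the set of values that are in the cache, and, for each
address of the unbounded slow memory, the value (if any) stored in that word. -/
structure MemState (V : Type*) where
  cache : Finset V
  slow : ℕ → Option V

/-- The kinds of elementary actions of a schedule. -/
inductive PebbleAction (V : Type*) where
  | evict : PebbleAction V
  | compute (v : V) : PebbleAction V
  | read : PebbleAction V
  | write : PebbleAction V

/-- One step of the execution of the computational DAG `G` with a cache of `M` words, where one
I/O operation moves words lying in one block of `B` consecutive addresses of the slow memory. -/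
inductive Step {V : Type*} (G : Digraph V) (M B : ℕ) :
    MemState V → PebbleAction V → MemState V → Prop where
  /-- Values may be discarded from the cache at any time, free of charge. -/
  | evict {c c' : Finset V} {s : ℕ → Option V} (hc : c' ⊆ c) :
      Step G M B ⟨c, s⟩ PebbleAction.evict ⟨c', s⟩
  /-- A non-input value is computed when all its operands are in the cache; the result is put into
  the cache, possibly in the place of values held there before (an operand, for example). -/
  | compute {c c' : Finset V} {s : ℕ → Option V} {v : V}
      (hv : ¬ IsInputVertex G v) (hop : ∀ u, G.Adj u v → u ∈ c)
      (hmem : v ∈ c') (hc : ∀ u ∈ c', u = v ∨ u ∈ c) (hM : c'.card ≤ M) :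
      Step G M B ⟨c, s⟩ (PebbleAction.compute v) ⟨c', s⟩
  /-- Values stored at the addresses `a, …, a + B - 1` are copied into the cache, possibly in the
  place of values held there before. -/
  | read {c c' : Finset V} {s : ℕ → Option V} (a : ℕ)
      (hc : ∀ u ∈ c', u ∈ c ∨ ∃ x, a ≤ x ∧ x < a + B ∧ s x = some u) (hM : c'.card ≤ M) :
      Step G M B ⟨c, s⟩ PebbleAction.read ⟨c', s⟩
  /-- Values of the cache are copied to some of the addresses `a, …, a + B - 1`. -/
  | write {c : Finset V} {s s' : ℕ → Option V} (a : ℕ)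
      (hs : ∀ x, s' x = s x ∨ (a ≤ x ∧ x < a + B ∧ ∃ u ∈ c, s' x = some u)) :
      Step G M B ⟨c, s⟩ PebbleAction.write ⟨c, s'⟩

/-- `Run G M B σ C τ`: executing the list of actions `C` can lead from state `σ` to state `τ`. -/
inductive Run {V : Type*} (G : Digraph V) (M B : ℕ) :
    MemState V → List (PebbleAction V) → MemState V → Prop where
  | nil (σ : MemState V) : Run G M B σ [] σ
  | cons {σ τ ρ : MemState V} {a : PebbleAction V} {C : List (PebbleAction V)}
      (h : Step G M B σ a τ) (hC : Run G M B τ C ρ) : Run G M B σ (a :: C) ρ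

/-- `C` is a computational schedule for `G`: it starts with an empty cache and with a slow memory
holding the input values and nothing else (in any layout), and ends with all output values stored
in the slow memory. -/
def IsSchedule {V : Type*} (G : Digraph V) (M B : ℕ) (C : List (PebbleAction V)) : Prop :=
  ∃ σ τ : MemState V,
    σ.cache = ∅ ∧
    (∀ v, (∃ x, σ.slow x = some v) ↔ IsInputVertex G v) ∧
    Run G M B σ C τ ∧
    ∀ v, IsOutputVertex G v → ∃ x, τ.slow x = some v

/-- Reads and writes are the I/O operations. -/
def PebbleAction.isTransfer {V : Type*} : PebbleAction V → Bool
  | .evict => false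
  | .compute _ => false
  | .read => true
  | .write => true

/-- The number of I/O operations of a schedule. -/
def ioCount {V : Type*} (C : List (PebbleAction V)) : ℕ := C.countP PebbleAction.isTransfer

/-- The value computed by an action, if any. -/
def PebbleAction.computed {V : Type*} : PebbleAction V → Option V
  | .compute v => some v
  | _ => none

/-- No value is computed more than once. -/
def NoRecomputation {V : Type*} (C : List (PebbleAction V)) : Prop :=
  (C.filterMap PebbleAction.computed).Nodup

/-! ### The family of DAGs of the dynamic programs -/

/-- A (finite) binary tree with `l` leaves, labelled by `Fin l`, with all edges directed towards the
root: `parent u = some w` means that there is an edge from `u` to `w`. Each vertex has at most two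
children. The shape of the tree and the placement of the labels on the leaves are arbitrary. -/
structure AccTree (l : ℕ) where
  Node : Type
  finite_node : Finite Node
  root : Node
  parent : Node → Option Node
  parent_eq_none : ∀ u, parent u = none ↔ u = root
  reaches_root : ∀ u, Relation.ReflTransGen (fun u w => parent u = some w) u root
  children_le_two : ∀ w, {u | parent u = some w}.ncard ≤ 2
  leaf : Fin l → Node
  leaf_injective : Function.Injective leaf
  mem_range_leaf : ∀ w, w ∈ Set.range leaf ↔ ∀ u, parent u ≠ some w

/-- The indices `1 ≤ lo < hi ≤ n` of the subproblems `S(lo, hi)` that are not base cases. -/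
structure Subproblem (n : ℕ) where
  lo : ℕ
  hi : ℕ
  one_le_lo : 1 ≤ lo
  lo_lt_hi : lo < hi
  hi_le : hi ≤ n

/-- A member of the family `𝒢(n)` is given by the choice, for each subproblem `S(i, j)` with
`1 ≤ i < j ≤ n`, of a binary tree with `j - i` leaves. -/
structure DPCdag (n : ℕ) where
  tree : (p : Subproblem n) → AccTree (p.hi - p.lo)

namespace DPCdag

variable {n : ℕ}

/-- The vertices: the `n` inputs `S(i, i)`, and the disjoint union of the vertices of the trees. -/
inductive Vertex (G : DPCdag n) where
  | input (i : ℕ) (h1 : 1 ≤ i) (hn : i ≤ n) : Vertex G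
  | node (p : Subproblem n) (u : (G.tree p).Node) : Vertex G

/-- The vertex `v_{i,j}` carrying the solution of `S(i, j)`: the input vertex if `i = j`, and the
root of the tree of `S(i, j)` if `i < j`. -/
def rootVertex (G : DPCdag n) (i j : ℕ) (h1 : 1 ≤ i) (hij : i ≤ j) (hn : j ≤ n) : G.Vertex :=
  if h : i = j then Vertex.input i h1 (hij.trans hn)
  else Vertex.node ⟨i, j, h1, lt_of_le_of_ne hij h, hn⟩ (G.tree _).root

/-- The edges: those of the trees, and, for the `k`-th leaf of the tree of `S(i, j)`, the edges from
`v_{i,i+k}` and `v_{i+k+1,j}` to that leaf. -/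
inductive Edge (G : DPCdag n) : G.Vertex → G.Vertex → Prop where
  | inner (p : Subproblem n) (u w : (G.tree p).Node) (h : (G.tree p).parent u = some w) :
      Edge G (Vertex.node p u) (Vertex.node p w)
  | left (p : Subproblem n) (k : Fin (p.hi - p.lo)) :
      Edge G
        (G.rootVertex p.lo (p.lo + k) p.one_le_lo (by omega)
          (by have := p.hi_le; have := k.isLt; omega))
        (Vertex.node p ((G.tree p).leaf k))
  | right (p : Subproblem n) (k : Fin (p.hi - p.lo)) :
      Edge G
        (G.rootVertex (p.lo + k + 1) p.hi (by omega)
          (by have := k.isLt; omega) p.hi_le)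
        (Vertex.node p ((G.tree p).leaf k))

/-- The computational DAG itself. -/
def graph (G : DPCdag n) : Digraph G.Vertex := ⟨G.Edge⟩

end DPCdag

/-! This is a segment argument combined with a Loomis–Whitney inequality. A leaf is a triple (i, j,
k): its left operand records (i, k), its right operand (i + k + 1, j), its tree (i, j). Consider a
contiguous part of the schedule with q I/O operations in which r tree roots are computed, and let N
= M + Bq + r. Every operand of a leaf computed there was in the cache at the start, was read, or is
a root computed in the part; so there are at most N left and at most N right operands. Since nothing
is recomputed, a tree with a leaf computed in the part either has its root computed there or leaves
a partial result in the cache or in the words written; so at most N trees are touched. By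
`card_sq_le_mul_card_image` the number of leaves is at most N^(3/2) (`ValidRun.sq_leafCount_le`).
Cut the schedule into parts with ⌊8 M^(3/2)⌋ leaves each. Then N ≥ 4M, so Bq + r ≥ 3M in each part
(`three_mul_le_of_sqrt_sq_le`, `ValidRun.segments`). All (n³ - n)/6 leaves must be computed, and the
r's sum to at most n(n + 1)/2, because each root is computed once. The bound n comes from reading
every input (`ValidRun.le_mul_ioCount`). -/

section

open Finset

/-! ### Combinatorial preliminaries -/

/-- A discrete Loomis–Whitney inequality: `hinj` says that a pair of points with the same image
under `h` is determined by the image under `f` of the first and the image under `g` of the second. -/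
theorem card_sq_le_mul_card_image {T α β γ : Type*} [DecidableEq α] [DecidableEq β] [DecidableEq γ]
    (S : Finset T) (f : T → α) (g : T → β) (h : T → γ)
    (hinj : ∀ t t' s s', h t = h t' → h s = h s' → f t = f s → g t' = g s' → t = s ∧ t' = s') :
    S.card ^ 2 ≤ (S.image f).card * (S.image g).card * (S.image h).card := by
  classical
  have h1 : S.card = ∑ c ∈ S.image h, (S.filter (fun t => h t = c)).card :=
    Finset.card_eq_sum_card_image h S
  -- The sum of the squared fibre sizes of `h` counts pairs in a common fibre. These inject into the
  -- product of the other two images, and Cauchy–Schwarz over the fibres concludes.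
  have h2 : ∑ c ∈ S.image h, (S.filter (fun t => h t = c)).card ^ 2
      = ((S ×ˢ S).filter (fun q => h q.1 = h q.2)).card := by
    rw [Finset.card_eq_sum_card_fiberwise (f := fun q : T × T => h q.1) (t := S.image h)]
    · refine Finset.sum_congr rfl fun c _ => ?_
      rw [sq, ← Finset.card_product]
      congr 1
      ext ⟨a, b⟩
      simp only [mem_product, mem_filter]
      constructor
      · rintro ⟨⟨ha, rfl⟩, hb, hb'⟩
        exact ⟨⟨⟨ha, hb⟩, hb'.symm⟩, rfl⟩
      · rintro ⟨⟨⟨ha, hb⟩, hab⟩, rfl⟩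
        exact ⟨⟨ha, rfl⟩, hb, hab.symm⟩
    · intro q hq
      simp only [coe_filter, mem_product, Set.mem_ofPred_eq] at hq
      exact Finset.mem_coe.2 (Finset.mem_image_of_mem h hq.1.1)
  have h3 : ((S ×ˢ S).filter (fun q => h q.1 = h q.2)).card
      ≤ (S.image f ×ˢ S.image g).card := by
    refine Finset.card_le_card_of_injOn (fun q => (f q.1, g q.2)) ?_ ?_
    · intro q hq
      simp only [coe_filter, mem_product, Set.mem_ofPred_eq] at hq
      exact Finset.mem_coe.2 (Finset.mem_product.2
        ⟨Finset.mem_image_of_mem f hq.1.1, Finset.mem_image_of_mem g hq.1.2⟩)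
    · rintro ⟨t, t'⟩ hq ⟨s, s'⟩ hr heq
      simp only [coe_filter, mem_product, Set.mem_ofPred_eq] at hq hr
      simp only [Prod.mk.injEq] at heq ⊢
      exact hinj t t' s s' hq.2 hr.2 heq.1 heq.2
  calc S.card ^ 2 = (∑ c ∈ S.image h, (S.filter (fun t => h t = c)).card) ^ 2 := by rw [← h1]
    _ ≤ (S.image h).card * ∑ c ∈ S.image h, (S.filter (fun t => h t = c)).card ^ 2 :=
        sq_sum_le_card_mul_sum_sq
    _ ≤ (S.image h).card * ((S.image f).card * (S.image g).card) := by
        rw [h2, ← Finset.card_product (S.image f)]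
        exact Nat.mul_le_mul_left _ h3
    _ = _ := by ring

/-- A list with at least `k` entries satisfying `p` has a prefix with exactly `k` of them. -/
theorem List.exists_append_countP_eq {α : Type*} (p : α → Bool) :
    ∀ (l : List α) (k : ℕ), k ≤ l.countP p → ∃ l₁ l₂, l = l₁ ++ l₂ ∧ l₁.countP p = k := by
  intro l
  induction l with
  | nil =>
    intro k hk
    exact ⟨[], [], rfl, by simp at hk ⊢; omega⟩
  | cons a l ih =>
    intro k hk
    rcases Nat.eq_zero_or_pos k with rfl | hpos
    · exact ⟨[], a :: l, rfl, rfl⟩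
    by_cases ha : p a = true
    · rw [List.countP_cons_of_pos ha] at hk
      obtain ⟨l₁, l₂, rfl, h⟩ := ih (k - 1) (by omega)
      exact ⟨a :: l₁, l₂, rfl, by rw [List.countP_cons_of_pos ha]; omega⟩
    · rw [List.countP_cons_of_neg ha] at hk
      obtain ⟨l₁, l₂, rfl, h⟩ := ih k hk
      exact ⟨a :: l₁, l₂, rfl, by rw [List.countP_cons_of_neg ha]; exact h⟩

/-! ### Runs of the machine -/

section Machine

variable {V : Type*} {G : Digraph V} {M B : ℕ}

/-- A value is present in a state if it is in one of the two memory levels. -/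
def MemState.Present (σ : MemState V) (v : V) : Prop := v ∈ σ.cache ∨ ∃ x, σ.slow x = some v

/-- The list of the values computed by a list of actions. -/
def computedValues (C : List (PebbleAction V)) : List V := C.filterMap PebbleAction.computed

theorem computedValues_append (C D : List (PebbleAction V)) :
    computedValues (C ++ D) = computedValues C ++ computedValues D :=
  List.filterMap_append

theorem ioCount_append (C D : List (PebbleAction V)) : ioCount (C ++ D) = ioCount C + ioCount D :=
  List.countP_append

theorem computedValues_cons (a : PebbleAction V) (C : List (PebbleAction V)) :
    computedValues (a :: C) = computedValues [a] ++ computedValues C :=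
  computedValues_append [a] C

theorem ioCount_cons (a : PebbleAction V) (C : List (PebbleAction V)) :
    ioCount (a :: C) = ioCount [a] + ioCount C :=
  ioCount_append [a] C

theorem Run.exists_of_append {σ τ : MemState V} {C D : List (PebbleAction V)}
    (h : Run G M B σ (C ++ D) τ) : ∃ ρ, Run G M B σ C ρ ∧ Run G M B ρ D τ := by
  induction C generalizing σ with
  | nil => exact ⟨σ, .nil σ, h⟩
  | cons a C ih =>
    cases h with
    | cons h1 h2 =>
      obtain ⟨ρ, h3, h4⟩ := ih h2
      exact ⟨ρ, .cons h1 h3, h4⟩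

theorem Run.card_cache_le {σ τ : MemState V} {C : List (PebbleAction V)}
    (h : Run G M B σ C τ) (hσ : σ.cache.card ≤ M) : τ.cache.card ≤ M := by
  induction h with
  | nil => exact hσ
  | cons h1 _ ih =>
    apply ih
    cases h1 with
    | evict hc => exact (Finset.card_le_card hc).trans hσ
    | compute _ _ _ _ hM => exact hM
    | read _ _ hM => exact hM
    | write => exact hσ

theorem Run.not_isInputVertex {σ τ : MemState V} {C : List (PebbleAction V)}
    (h : Run G M B σ C τ) {v : V} (hv : v ∈ computedValues C) : ¬ IsInputVertex G v := by
  induction h with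
  | nil => simp [computedValues] at hv
  | cons h1 _ ih =>
    rw [computedValues_cons, List.mem_append] at hv
    rcases hv with hv | hv
    · cases h1 <;> simp [computedValues, PebbleAction.computed] at hv
      subst hv
      assumption
    · exact ih hv

/-- The at most `B` values stored in a block. -/
theorem exists_finset_block (s : ℕ → Option V) (a B : ℕ) :
    ∃ R : Finset V, R.card ≤ B ∧ ∀ x u, a ≤ x → x < a + B → s x = some u → u ∈ R := by
  classical
  refine ⟨(Finset.Ico a (a + B)).biUnion fun x => (s x).toFinset, ?_, ?_⟩
  · refine (Finset.card_biUnion_le_card_mul _ _ 1 fun x _ => ?_).trans (by simp)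
    cases s x <;> simp
  · intro x u h1 h2 h3
    exact Finset.mem_biUnion.2 ⟨x, Finset.mem_Ico.2 ⟨h1, h2⟩, by simp [h3]⟩

/-- The values a step may find in or bring into the cache. -/
theorem Step.exists_finset_read {σ τ : MemState V} {a : PebbleAction V} (h : Step G M B σ a τ) :
    ∃ R : Finset V, R.card ≤ B * ioCount [a] ∧
      (∀ u ∈ τ.cache, u ∈ σ.cache ∨ u ∈ R ∨ u ∈ computedValues [a]) ∧
      ∀ v ∈ computedValues [a], ∀ u, G.Adj u v → u ∈ σ.cache := by
  cases h with
  | evict hc =>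
    exact ⟨∅, by simp, fun u hu => .inl (hc hu), by simp [computedValues, PebbleAction.computed]⟩
  | compute hv hop hmem hc hM =>
    refine ⟨∅, by simp, fun u hu => ?_, ?_⟩
    · rcases hc u hu with rfl | h
      · exact .inr (.inr (by simp [computedValues, PebbleAction.computed]))
      · exact .inl h
    · intro v hv' u hu
      simp [computedValues, PebbleAction.computed] at hv'
      subst hv'
      exact hop u hu
  | @read c c' s a hc hM =>
    obtain ⟨R, hR, hR'⟩ := exists_finset_block s a B
    refine ⟨R, by simpa [ioCount, PebbleAction.isTransfer] using hR, fun u hu => ?_,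
      by simp [computedValues, PebbleAction.computed]⟩
    rcases hc u hu with h | ⟨x, h1, h2, h3⟩
    · exact .inl h
    · exact .inr (.inl (hR' x u h1 h2 h3))
  | write a hs =>
    exact ⟨∅, by simp, fun u hu => .inl hu, by simp [computedValues, PebbleAction.computed]⟩

/-- The values a step may bring into the slow memory. -/
theorem Step.exists_finset_write {σ τ : MemState V} {a : PebbleAction V} (h : Step G M B σ a τ) :
    ∃ W : Finset V, W.card ≤ B * ioCount [a] ∧
      ∀ u, (∃ x, τ.slow x = some u) → (∃ x, σ.slow x = some u) ∨ (u ∈ W ∧ u ∈ σ.cache) := by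
  classical
  cases h with
  | evict hc => exact ⟨∅, by simp, fun u hu => .inl hu⟩
  | compute hv hop hmem hc hM => exact ⟨∅, by simp, fun u hu => .inl hu⟩
  | read a hc hM => exact ⟨∅, by simp, fun u hu => .inl hu⟩
  | @write c s s' a hs =>
    obtain ⟨R, hR, hR'⟩ := exists_finset_block s' a B
    refine ⟨R, by simpa [ioCount, PebbleAction.isTransfer] using hR, ?_⟩
    rintro u ⟨x, hx⟩
    rcases hs x with h | ⟨h1, h2, w, hw, h3⟩
    · exact .inl ⟨x, h.symm.trans hx⟩
    · have hx' : s' x = some u := hx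
      obtain rfl : w = u := by simpa [h3] using hx'
      exact .inr ⟨hR' x w h1 h2 hx, hw⟩

/-- `R` collects the blocks read during the run. In the induction an operand found in the
intermediate cache is traced back through the first step. -/
theorem Run.exists_finset_read {σ τ : MemState V} {C : List (PebbleAction V)}
    (h : Run G M B σ C τ) :
    ∃ R : Finset V, R.card ≤ B * ioCount C ∧
      ∀ v ∈ computedValues C, ∀ u, G.Adj u v →
        u ∈ σ.cache ∨ u ∈ R ∨ u ∈ computedValues C := by
  classical
  induction h with
  | nil => exact ⟨∅, by simp, by simp [computedValues]⟩
  | @cons σ τ ρ a C h1 _ ih =>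
    obtain ⟨R, hR, hR'⟩ := ih
    obtain ⟨S, hS, hS', hS''⟩ := h1.exists_finset_read
    refine ⟨S ∪ R, ?_, ?_⟩
    · rw [ioCount_cons, mul_add]
      exact (Finset.card_union_le _ _).trans (add_le_add hS hR)
    · intro v hv u hu
      rw [computedValues_cons, List.mem_append] at hv ⊢
      rw [Finset.mem_union]
      rcases hv with hv | hv
      · exact .inl (hS'' v hv u hu)
      · rcases hR' v hv u hu with h | h | h
        · rcases hS' u h with h | h | h <;> tauto
        · tauto
        · tauto

theorem Run.exists_finset_write {σ τ : MemState V} {C : List (PebbleAction V)}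
    (h : Run G M B σ C τ) :
    ∃ W : Finset V, W.card ≤ B * ioCount C ∧
      ∀ u, (∃ x, τ.slow x = some u) → (∃ x, σ.slow x = some u) ∨ u ∈ W := by
  classical
  induction h with
  | nil => exact ⟨∅, by simp, fun u hu => .inl hu⟩
  | @cons σ τ ρ a C h1 _ ih =>
    obtain ⟨W, hW, hW'⟩ := ih
    obtain ⟨S, hS, hS'⟩ := h1.exists_finset_write
    refine ⟨S ∪ W, ?_, fun u hu => ?_⟩
    · rw [ioCount_cons, mul_add]
      exact (Finset.card_union_le _ _).trans (add_le_add hS hW)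
    · rw [Finset.mem_union]
      rcases hW' u hu with h | h
      · rcases hS' u h with h | h <;> tauto
      · tauto

theorem Step.present {σ τ : MemState V} {a : PebbleAction V} (h : Step G M B σ a τ) {u : V}
    (hu : τ.Present u) : σ.Present u ∨ u ∈ computedValues [a] := by
  rcases hu with hu | hu
  · cases h with
    | evict hc => exact .inl (.inl (hc hu))
    | compute hv hop hmem hc hM =>
      rcases hc u hu with rfl | h
      · exact .inr (by simp [computedValues, PebbleAction.computed])
      · exact .inl (.inl h)
    | read a hc hM =>
      rcases hc u hu with h | ⟨x, _, _, h⟩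
      · exact .inl (.inl h)
      · exact .inl (.inr ⟨x, h⟩)
    | write a hs => exact .inl (.inl hu)
  · obtain ⟨W, -, hW⟩ := h.exists_finset_write
    rcases hW u hu with h | h
    · exact .inl (.inr h)
    · exact .inl (.inl h.2)

/-- Every value that is present was present before or has been computed. -/
theorem Run.present {σ τ : MemState V} {C : List (PebbleAction V)} (h : Run G M B σ C τ) {u : V}
    (hu : τ.Present u) : σ.Present u ∨ u ∈ computedValues C := by
  induction h with
  | nil => exact .inl hu
  | cons h1 _ ih =>
    rw [computedValues_cons, List.mem_append]
    rcases ih hu with h | h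
    · rcases h1.present h with h | h <;> tauto
    · tauto

/-- The operands of a computed value were present before or have been computed. -/
theorem Run.present_of_adj {σ τ : MemState V} {C : List (PebbleAction V)} (h : Run G M B σ C τ)
    {u v : V} (hv : v ∈ computedValues C) (hu : G.Adj u v) :
    σ.Present u ∨ u ∈ computedValues C := by
  induction h with
  | nil => simp [computedValues] at hv
  | cons h1 _ ih =>
    rw [computedValues_cons, List.mem_append] at hv ⊢
    rcases hv with hv | hv
    · obtain ⟨R, -, -, hR⟩ := h1.exists_finset_read
      exact .inl (.inl (hR v hv u hu))
    · rcases ih hv with h | h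
      · rcases h1.present h with h | h <;> tauto
      · tauto

end Machine

/-! ### Structure of the DAGs -/

theorem Subproblem.ext_lo_hi {n : ℕ} {p q : Subproblem n} (h1 : p.lo = q.lo) (h2 : p.hi = q.hi) :
    p = q := by
  cases p
  cases q
  simp_all

namespace DPCdag

variable {n : ℕ} (G : DPCdag n)

/-- The indices of the leaves of all trees. -/
abbrev LeafIndex (n : ℕ) : Type := Σ p : Subproblem n, Fin (p.hi - p.lo)

/-- The leaf with a given index. -/
def leafVertex (t : LeafIndex n) : G.Vertex := .node t.1 ((G.tree t.1).leaf t.2)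

/-- The left operand of a leaf. -/
def leftOperand (t : LeafIndex n) : G.Vertex :=
  G.rootVertex t.1.lo (t.1.lo + t.2) t.1.one_le_lo (by omega)
    (by have := t.1.hi_le; have := t.2.isLt; omega)

/-- The right operand of a leaf. -/
def rightOperand (t : LeafIndex n) : G.Vertex :=
  G.rootVertex (t.1.lo + t.2 + 1) t.1.hi (by omega) (by have := t.2.isLt; omega) t.1.hi_le

/-- The root of the tree of a subproblem. -/
def treeRoot (p : Subproblem n) : G.Vertex := .node p (G.tree p).root

variable {G}

/-- The tree a vertex belongs to. -/
def Vertex.subproblem : G.Vertex → Option (Subproblem n)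
  | .input _ _ _ => none
  | .node p _ => some p

theorem adj_leftOperand (t : LeafIndex n) : G.graph.Adj (G.leftOperand t) (G.leafVertex t) :=
  Edge.left t.1 t.2

theorem adj_rightOperand (t : LeafIndex n) : G.graph.Adj (G.rightOperand t) (G.leafVertex t) :=
  Edge.right t.1 t.2

theorem leafVertex_injective : Function.Injective G.leafVertex := by
  rintro ⟨p, k⟩ ⟨q, l⟩ h
  simp only [leafVertex, Vertex.node.injEq] at h
  obtain ⟨rfl, h⟩ := h
  rw [(G.tree p).leaf_injective (eq_of_heq h)]

theorem treeRoot_injective : Function.Injective G.treeRoot := by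
  intro p q h
  simp only [treeRoot, Vertex.node.injEq] at h
  exact h.1

theorem rootVertex_of_lt {i j : ℕ} (h1 : 1 ≤ i) (hij : i < j) (hn : j ≤ n) :
    G.rootVertex i j h1 hij.le hn = G.treeRoot ⟨i, j, h1, hij, hn⟩ := by
  rw [rootVertex, dif_neg hij.ne]
  rfl

theorem rootVertex_self {i : ℕ} (h1 : 1 ≤ i) (hn : i ≤ n) :
    G.rootVertex i i h1 le_rfl hn = .input i h1 hn := by
  rw [rootVertex, dif_pos rfl]

theorem rootVertex_inj {i j i' j' : ℕ} {h1 : 1 ≤ i} {hij : i ≤ j} {hn : j ≤ n}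
    {h1' : 1 ≤ i'} {hij' : i' ≤ j'} {hn' : j' ≤ n}
    (h : G.rootVertex i j h1 hij hn = G.rootVertex i' j' h1' hij' hn') : i = i' ∧ j = j' := by
  rcases hij.eq_or_lt with rfl | hlt <;> rcases hij'.eq_or_lt with rfl | hlt'
  · rw [rootVertex_self, rootVertex_self] at h
    simpa using h
  · rw [rootVertex_self, rootVertex_of_lt _ hlt'] at h
    simp [treeRoot] at h
  · rw [rootVertex_self, rootVertex_of_lt _ hlt] at h
    simp [treeRoot] at h
  · rw [rootVertex_of_lt _ hlt, rootVertex_of_lt _ hlt'] at h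
    simpa using treeRoot_injective h

/-- Together with the tree, the two operands act as coordinate projections of a leaf; this lemma and
the next say which coordinates each operand retains. -/
theorem leftOperand_eq {s t : LeafIndex n} (h : G.leftOperand s = G.leftOperand t) :
    s.1.lo = t.1.lo ∧ (s.2 : ℕ) = t.2 := by
  obtain ⟨h1, h2⟩ := rootVertex_inj h
  omega

theorem rightOperand_eq {s t : LeafIndex n} (h : G.rightOperand s = G.rightOperand t) :
    s.1.lo + (s.2 : ℕ) = t.1.lo + t.2 ∧ s.1.hi = t.1.hi := by
  obtain ⟨h1, h2⟩ := rootVertex_inj h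
  omega

theorem LeafIndex.ext_val {s t : LeafIndex n} (h : s.1 = t.1) (h2 : (s.2 : ℕ) = t.2) : s = t := by
  obtain ⟨p, k⟩ := s
  obtain ⟨q, l⟩ := t
  obtain rfl : p = q := h
  obtain rfl : k = l := Fin.ext h2
  rfl

theorem isInputVertex_input {i : ℕ} (h1 : 1 ≤ i) (hn : i ≤ n) :
    IsInputVertex G.graph (.input i h1 hn) := by
  intro u hu
  cases hu

theorem not_isInputVertex_node (p : Subproblem n) (u : (G.tree p).Node) :
    ¬ IsInputVertex G.graph (.node p u) := by
  intro h
  by_cases hu : u ∈ Set.range (G.tree p).leaf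
  · obtain ⟨k, rfl⟩ := hu
    exact h _ (adj_leftOperand ⟨p, k⟩)
  · rw [(G.tree p).mem_range_leaf] at hu
    push Not at hu
    obtain ⟨w, hw⟩ := hu
    exact h _ (Edge.inner p w u hw)

/-- An operand which is not the input of a base case is the root of a tree. -/
theorem rootVertex_cases {i j : ℕ} (h1 : 1 ≤ i) (hij : i ≤ j) (hn : j ≤ n) :
    IsInputVertex G.graph (G.rootVertex i j h1 hij hn) ∨
      G.rootVertex i j h1 hij hn ∈ Set.range G.treeRoot := by
  rcases hij.eq_or_lt with rfl | hlt
  · rw [rootVertex_self]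
    exact .inl (isInputVertex_input _ _)
  · rw [rootVertex_of_lt h1 hlt hn]
    exact .inr ⟨_, rfl⟩

/-- Every solution except the final one is an operand of a leaf of a larger subproblem. -/
theorem exists_adj_leafVertex {i j : ℕ} (h1 : 1 ≤ i) (hij : i ≤ j) (hn : j ≤ n)
    (hne : ¬ (i = 1 ∧ j = n)) :
    ∃ t : LeafIndex n, j - i < t.1.hi - t.1.lo ∧
      G.graph.Adj (G.rootVertex i j h1 hij hn) (G.leafVertex t) := by
  by_cases hj : j < n
  -- S(i, j) is the left operand of the last leaf of S(i, j + 1). When j = n it is instead the right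
  -- operand of leaf 0 of S(i - 1, n).
  · refine ⟨⟨⟨i, j + 1, h1, by omega, hj⟩, ⟨j - i, by simp only; omega⟩⟩, by simp only; omega, ?_⟩
    convert adj_leftOperand (G := G) _ using 1
    simp only [leftOperand]
    congr 1
    omega
  · refine ⟨⟨⟨i - 1, j, by omega, by omega, hn⟩, ⟨0, by simp only; omega⟩⟩,
      by simp only; omega, ?_⟩
    convert adj_rightOperand (G := G) _ using 1
    simp only [rightOperand]
    congr 1
    omega

/-- A root has no parent in its tree; a left operand ends strictly before the end of its subproblem,
and a right operand starts strictly after the beginning. -/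
theorem isOutputVertex_treeRoot (hn : 1 < n) :
    IsOutputVertex G.graph (G.treeRoot ⟨1, n, le_rfl, hn, le_rfl⟩) := by
  intro w hw
  change G.Edge _ _ at hw
  rw [← rootVertex_of_lt le_rfl hn le_rfl] at hw
  generalize hv : G.rootVertex 1 n le_rfl hn.le le_rfl = v at hw
  cases hw with
  | inner p u w h =>
    rw [rootVertex_of_lt le_rfl hn le_rfl] at hv
    simp only [treeRoot, Vertex.node.injEq] at hv
    obtain ⟨rfl, hv⟩ := hv
    obtain rfl := eq_of_heq hv
    rw [((G.tree _).parent_eq_none _).2 rfl] at h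
    cases h
  | left p k =>
    have h1 := (rootVertex_inj hv).2
    have h2 := k.isLt
    have h3 := p.hi_le
    omega
  | right p k =>
    have h1 := (rootVertex_inj hv).1
    have h2 := p.one_le_lo
    omega

/-! ### Counting leaves and roots -/

theorem two_mul_sum_range_id (j : ℕ) : 2 * (∑ m ∈ range j, (m : ℤ)) = j * (j - 1) := by
  induction j with
  | zero => simp
  | succ j ih =>
    rw [Finset.sum_range_succ, mul_add, ih]
    push_cast
    ring

theorem six_mul_sum_sum_range (n : ℕ) :
    6 * (∑ j ∈ range (n + 1), ∑ m ∈ range j, (m : ℤ)) = (n : ℤ) ^ 3 - n := by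
  induction n with
  | zero => simp
  | succ n ih =>
    rw [Finset.sum_range_succ, mul_add, ih]
    have := two_mul_sum_range_id (n + 1)
    push_cast at this ⊢
    linear_combination 3 * this

/-- There are `(n ^ 3 - n) / 6` leaves. -/
theorem exists_finset_leafIndex (n : ℕ) :
    ∃ S : Finset (LeafIndex n), n ^ 3 ≤ 6 * S.card + n := by
  classical
  -- Entries are (j, m, i) with 1 ≤ i ≤ m < j ≤ n, where m = i + k is the last index of the left
  -- operand.
  let T : Finset (Σ _ : ℕ, Σ _ : ℕ, ℕ) :=
    (range (n + 1)).sigma fun j => (range j).sigma fun m => Finset.Icc 1 m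
  have hT : (6 * T.card : ℤ) = (n : ℤ) ^ 3 - n := by
    rw [← six_mul_sum_sum_range n]
    simp [T, Finset.card_sigma]
  have hmem : ∀ x ∈ T, 1 ≤ x.2.2 ∧ x.2.2 ≤ x.2.1 ∧ x.2.1 < x.1 ∧ x.1 ≤ n := by
    intro x hx
    simp only [T, Finset.mem_sigma, Finset.mem_range, Finset.mem_Icc] at hx
    omega
  let f : T → LeafIndex n := fun x =>
    ⟨⟨x.1.2.2, x.1.1, (hmem _ x.2).1, by have := hmem _ x.2; omega, (hmem _ x.2).2.2.2⟩,
      ⟨x.1.2.1 - x.1.2.2, by have := hmem _ x.2; simp only; omega⟩⟩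
  have hf : Function.Injective f := by
    intro x y hxy
    have hx := hmem _ x.2
    have hy := hmem _ y.2
    have h1 : (f x).1.lo = (f y).1.lo := by rw [hxy]
    have h2 : (f x).1.hi = (f y).1.hi := by rw [hxy]
    have h3 : ((f x).2 : ℕ) = (f y).2 := by rw [hxy]
    obtain ⟨⟨a, b, c⟩, hx'⟩ := x
    obtain ⟨⟨a', b', c'⟩, hy'⟩ := y
    simp only [f] at h1 h2 h3 hx hy
    obtain rfl : a = a' := h2
    obtain rfl : c = c' := h1
    obtain rfl : b = b' := by omega
    rfl
  refine ⟨Finset.univ.map ⟨f, hf⟩, ?_⟩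
  rw [Finset.card_map, Finset.card_univ, Fintype.card_coe]
  zify
  linarith

theorem two_mul_card_subproblem_le (S : Finset (Subproblem n)) : 2 * S.card ≤ n * (n + 1) := by
  classical
  -- The value lo = 0 is allowed in this overcount, which yields n(n + 1)/2 in place of n(n - 1)/2.
  have h : S.card ≤ ((range (n + 1)).sigma fun j => range j).card := by
    refine Finset.card_le_card_of_injOn (fun p => ⟨p.hi, p.lo⟩) ?_ ?_
    · intro p _
      have h1 := p.lo_lt_hi
      have h2 := p.hi_le
      simp only [coe_sigma, Set.mem_sigma_iff, mem_coe, mem_range]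
      omega
    · intro p _ q _ h
      simp only [Sigma.mk.injEq, heq_eq_eq] at h
      exact Subproblem.ext_lo_hi h.2 h.1
  rw [Finset.card_sigma] at h
  simp only [card_range] at h
  have h2 := two_mul_sum_range_id (n + 1)
  zify at h ⊢
  push_cast at h2
  linarith

/-! ### Schedules -/

/-- A schedule without recomputation for a member of the family, with its initial state. -/
structure ValidRun (G : DPCdag n) (M B : ℕ) (C : List (PebbleAction G.Vertex))
    (σ τ : MemState G.Vertex) : Prop where
  cache_eq : σ.cache = ∅
  slow_iff : ∀ v, (∃ x, σ.slow x = some v) ↔ IsInputVertex G.graph v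
  run : Run G.graph M B σ C τ
  output : ∀ v, IsOutputVertex G.graph v → ∃ x, τ.slow x = some v
  nodup : (computedValues C).Nodup

namespace ValidRun

variable {M B : ℕ} {C : List (PebbleAction G.Vertex)} {σ τ : MemState G.Vertex}

theorem isInputVertex_of_present (h : ValidRun G M B C σ τ) {v : G.Vertex} (hv : σ.Present v) :
    IsInputVertex G.graph v := by
  rcases hv with hv | hv
  · simp [h.cache_eq] at hv
  · exact (h.slow_iff v).1 hv

/-- Descend from the root: each child of a computed vertex must have been available, and a tree
vertex, not being an input, can only become available by being computed. -/
theorem mem_computedValues_node (h : ValidRun G M B C σ τ) {p : Subproblem n}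
    (hp : G.treeRoot p ∈ computedValues C) (u : (G.tree p).Node) :
    Vertex.node p u ∈ computedValues C := by
  induction (G.tree p).reaches_root u using Relation.ReflTransGen.head_induction_on with
  | refl => exact hp
  | @head a b hab _ ih =>
    rcases h.run.present_of_adj ih (Edge.inner p a b hab) with h' | h'
    · exact absurd (h.isInputVertex_of_present h') (not_isInputVertex_node p a)
    · exact h'

/-- All values of the trees are computed. -/
theorem node_mem_computedValues (h : ValidRun G M B C σ τ) (p : Subproblem n)
    (u : (G.tree p).Node) : Vertex.node p u ∈ computedValues C := by
  -- Induction from long subproblems to short ones: d = 0 is vacuous, the full problem is forced by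
  -- the output condition, and any other solution is an operand of a leaf of a longer subproblem.
  suffices H : ∀ d : ℕ, ∀ p : Subproblem n, n ≤ d + (p.hi - p.lo) →
      G.treeRoot p ∈ computedValues C from
    h.mem_computedValues_node (H n p (by omega)) u
  intro d
  induction d with
  | zero =>
    intro p hp
    have := p.one_le_lo
    have := p.hi_le
    have := p.lo_lt_hi
    omega
  | succ d ih =>
    intro p hp
    obtain ⟨i, j, h1, hij, hj⟩ := p
    by_cases hne : i = 1 ∧ j = n
    · obtain ⟨rfl, rfl⟩ := hne
      rcases h.run.present (.inr (h.output _ (isOutputVertex_treeRoot hij))) with h' | h'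
      · exact absurd (h.isInputVertex_of_present h') (not_isInputVertex_node _ _)
      · exact h'
    · obtain ⟨t, ht, hadj⟩ := exists_adj_leafVertex (G := G) h1 hij.le hj hne
      have hleaf : G.leafVertex t ∈ computedValues C :=
        h.mem_computedValues_node (ih t.1 (by simp only at hp; omega)) _
      rw [rootVertex_of_lt h1 hij hj] at hadj
      rcases h.run.present_of_adj hleaf hadj with h' | h'
      · exact absurd (h.isInputVertex_of_present h') (not_isInputVertex_node _ _)
      · exact h'

/-- Every input has to be read. -/
theorem le_mul_ioCount (h : ValidRun G M B C σ τ) (hn : 2 ≤ n) : n ≤ B * ioCount C := by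
  classical
  obtain ⟨R, hR, hR'⟩ := h.run.exists_finset_read
  refine le_trans ?_ hR
  let f : Fin n → G.Vertex := fun i => .input (i + 1) (by omega) (by omega)
  have hf : Function.Injective f := by
    intro i j hij
    simp only [f, Vertex.input.injEq] at hij
    exact Fin.ext (by omega)
  have hsub : Finset.univ.map ⟨f, hf⟩ ⊆ R := by
    intro v hv
    simp only [mem_map, mem_univ, Function.Embedding.coeFn_mk, true_and] at hv
    obtain ⟨i, rfl⟩ := hv
    obtain ⟨t, -, hadj⟩ := exists_adj_leafVertex (G := G) (i := i + 1) (j := i + 1) (by omega)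
      le_rfl (by omega) (by omega)
    rw [rootVertex_self] at hadj
    rcases hR' _ (h.node_mem_computedValues _ _) _ hadj with h' | h' | h'
    · simp [h.cache_eq] at h'
    · exact h'
    · exact absurd (isInputVertex_input _ _) (h.run.not_isInputVertex h')
  simpa using Finset.card_le_card hsub

end ValidRun

/-! ### Leaves and roots computed in a part of the schedule -/

open Classical in
/-- The number of entries of a list of vertices that are leaves. -/
noncomputable def leafCount (G : DPCdag n) (C : List (PebbleAction G.Vertex)) : ℕ :=
  C.countP fun a => decide (∃ t, a.computed = some (G.leafVertex t))

open Classical in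
/-- The subproblems whose roots are computed by a list of actions. -/
noncomputable def computedRoots (G : DPCdag n) (C : List (PebbleAction G.Vertex)) :
    Finset (Subproblem n) :=
  (computedValues C).toFinset.preimage G.treeRoot treeRoot_injective.injOn

theorem mem_computedRoots {C : List (PebbleAction G.Vertex)} {p : Subproblem n} :
    p ∈ computedRoots G C ↔ G.treeRoot p ∈ computedValues C := by
  simp [computedRoots]

theorem card_computedRoots_append {C D : List (PebbleAction G.Vertex)}
    (h : (computedValues (C ++ D)).Nodup) :
    (computedRoots G (C ++ D)).card = (computedRoots G C).card + (computedRoots G D).card := by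
  classical
  rw [← Finset.card_union_of_disjoint]
  · congr 1
    ext p
    simp [mem_computedRoots, computedValues_append]
  · rw [Finset.disjoint_left]
    intro p hp hp'
    rw [mem_computedRoots] at hp hp'
    rw [computedValues_append] at h
    exact List.disjoint_of_nodup_append h hp hp'

open Classical in
/-- The leaves computed by a list of actions. -/
noncomputable def computedLeaves (G : DPCdag n) (C : List (PebbleAction G.Vertex)) :
    Finset (LeafIndex n) :=
  (computedValues C).toFinset.preimage G.leafVertex leafVertex_injective.injOn

theorem mem_computedLeaves {C : List (PebbleAction G.Vertex)} {t : LeafIndex n} :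
    t ∈ computedLeaves G C ↔ G.leafVertex t ∈ computedValues C := by
  simp [computedLeaves]

/-- Without recomputation, counting actions (convenient for cutting the list) agrees with counting
distinct leaves (needed for the Loomis–Whitney inequality). -/
theorem card_computedLeaves {C : List (PebbleAction G.Vertex)} (hC : (computedValues C).Nodup) :
    (computedLeaves G C).card = leafCount G C := by
  classical
  have h1 : leafCount G C = (computedValues C).countP (· ∈ Set.range G.leafVertex) := by
    rw [computedValues, List.countP_filterMap, leafCount]
    congr 1
    funext a
    cases h : a.computed <;> simp [eq_comm]
  rw [h1, computedLeaves, Finset.card_preimage, List.countP_eq_length_filter,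
    ← List.toFinset_card_of_nodup (hC.filter _), List.toFinset_filter]
  simp

/-- A number of leaves computed in a part of a schedule is bounded in terms of the transfers and
the computations of roots in that part. -/
theorem ValidRun.sq_leafCount_le {M B : ℕ} {C₁ C₂ C₃ : List (PebbleAction G.Vertex)}
    {σ τ : MemState G.Vertex} (h : ValidRun G M B (C₁ ++ (C₂ ++ C₃)) σ τ) :
    leafCount G C₂ ^ 2 ≤ (M + (B * ioCount C₂ + (computedRoots G C₂).card)) ^ 3 := by
  classical
  obtain ⟨σ₁, hr₁, hr⟩ := h.run.exists_of_append
  obtain ⟨σ₂, hr₂, hr₃⟩ := hr.exists_of_append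
  have hcard₁ : σ₁.cache.card ≤ M := hr₁.card_cache_le (by simp [h.cache_eq])
  have hcard₂ : σ₂.cache.card ≤ M := hr₂.card_cache_le hcard₁
  have hnd := h.nodup
  rw [computedValues_append, computedValues_append, List.nodup_append'] at hnd
  obtain ⟨-, hnd₂₃, hdisj₁⟩ := hnd
  rw [List.nodup_append'] at hnd₂₃
  obtain ⟨hnd₂, -, hdisj₂⟩ := hnd₂₃
  rw [← card_computedLeaves hnd₂]
  obtain ⟨R, hR, hR'⟩ := hr₂.exists_finset_read
  obtain ⟨W, hW, hW'⟩ := hr₂.exists_finset_write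
  set Q : Finset G.Vertex := (computedRoots G C₂).image G.treeRoot with hQ
  have hQcard : Q.card ≤ (computedRoots G C₂).card := Finset.card_image_le
  -- An operand of a leaf is an input or a tree root, and inputs are never computed; so an operand
  -- computed in `C₂` lies in `Q`.
  have hroot : ∀ {i j : ℕ} (h1 : 1 ≤ i) (hij : i ≤ j) (hn : j ≤ n) (v : G.Vertex),
      v ∈ computedValues C₂ → G.graph.Adj (G.rootVertex i j h1 hij hn) v →
      G.rootVertex i j h1 hij hn ∈ σ₁.cache ∪ (R ∪ Q) := by
    intro i j h1 hij hn v hv hadj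
    rw [Finset.mem_union, Finset.mem_union]
    rcases hR' v hv _ hadj with h' | h' | h'
    · exact .inl h'
    · exact .inr (.inl h')
    · rcases rootVertex_cases (G := G) h1 hij hn with h'' | ⟨p, hp⟩
      · exact absurd h'' (hr₂.not_isInputVertex h')
      · rw [← hp] at h' ⊢
        exact .inr (.inr (Finset.mem_image_of_mem _ (mem_computedRoots.2 h')))
  have hbound : ∀ X Y : Finset G.Vertex, X.card ≤ M → Y.card ≤ B * ioCount C₂ →
      (X ∪ (Y ∪ Q)).card ≤ M + (B * ioCount C₂ + (computedRoots G C₂).card) := by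
    intro X Y hX hY
    have h1 := Finset.card_union_le X (Y ∪ Q)
    have h2 := Finset.card_union_le Y Q
    omega
  have hA : ((computedLeaves G C₂).image G.leftOperand).card
      ≤ M + (B * ioCount C₂ + (computedRoots G C₂).card) := by
    refine (Finset.card_le_card ?_).trans (hbound _ R hcard₁ hR)
    rw [Finset.image_subset_iff]
    intro t ht
    exact hroot _ _ _ _ (mem_computedLeaves.1 ht) (adj_leftOperand t)
  have hB : ((computedLeaves G C₂).image G.rightOperand).card
      ≤ M + (B * ioCount C₂ + (computedRoots G C₂).card) := by
    refine (Finset.card_le_card ?_).trans (hbound _ R hcard₁ hR)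
    rw [Finset.image_subset_iff]
    intro t ht
    exact hroot _ _ _ _ (mem_computedLeaves.1 ht) (adj_rightOperand t)
  -- Climb from `u` towards the root while the parent is also computed in `C₂`. If the climb stops
  -- at `a` below the root, the parent `b` is not computed in `C₁`, since `a` was not yet available;
  -- so it is computed in `C₃`. As `a` is not recomputed there, it must survive in the cache or the
  -- slow memory at the end of `C₂`, and in the latter case it was written during `C₂`.
  have hflow : ∀ (p : Subproblem n) (u : (G.tree p).Node), Vertex.node p u ∈ computedValues C₂ →
      ∃ w, Vertex.node p w ∈ σ₂.cache ∪ (W ∪ Q) := by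
    intro p u
    induction (G.tree p).reaches_root u using Relation.ReflTransGen.head_induction_on with
    | refl =>
      intro hu
      refine ⟨(G.tree p).root, ?_⟩
      rw [Finset.mem_union, Finset.mem_union]
      exact .inr (.inr (Finset.mem_image_of_mem G.treeRoot (mem_computedRoots.2 hu)))
    | @head a b hab _ ih =>
      intro ha
      have hadj : G.graph.Adj (.node p a) (.node p b) := Edge.inner p a b hab
      have hnot₁ : Vertex.node p a ∉ computedValues C₁ := fun h' =>
        hdisj₁ h' (List.mem_append_left _ ha)
      have hnotσ : ¬ σ₁.Present (Vertex.node p a) := fun h' => by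
        rcases hr₁.present h' with h' | h'
        · exact not_isInputVertex_node p a (h.isInputVertex_of_present h')
        · exact hnot₁ h'
      have hb := h.node_mem_computedValues p b
      rw [computedValues_append, computedValues_append, List.mem_append, List.mem_append] at hb
      rcases hb with hb | hb | hb
      · rcases hr₁.present_of_adj hb hadj with h' | h'
        · exact absurd (h.isInputVertex_of_present h') (not_isInputVertex_node p a)
        · exact absurd h' hnot₁
      · exact ih hb
      · refine ⟨a, ?_⟩
        rw [Finset.mem_union, Finset.mem_union]
        rcases hr₃.present_of_adj hb hadj with (h' | h') | h'
        · exact .inl h'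
        · rcases hW' _ h' with h' | h'
          · exact absurd (.inr h') hnotσ
          · exact .inr (.inl h')
        · exact absurd h' (hdisj₂ ha)
  have hC : ((computedLeaves G C₂).image Sigma.fst).card
      ≤ M + (B * ioCount C₂ + (computedRoots G C₂).card) := by
    refine le_trans ?_ (hbound _ W hcard₂ hW)
    -- Trees are counted through the witnesses of `hflow`; `Option` is needed because inputs belong
    -- to no tree.
    rw [← Finset.card_image_of_injective _ (Option.some_injective (Subproblem n))]
    refine (Finset.card_le_card ?_).trans
      (Finset.card_image_le (s := σ₂.cache ∪ (W ∪ Q)) (f := Vertex.subproblem))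
    intro x hx
    rw [Finset.image_image, Finset.mem_image] at hx
    obtain ⟨t, ht, rfl⟩ := hx
    obtain ⟨w, hw⟩ := hflow t.1 _ (mem_computedLeaves.1 ht)
    exact Finset.mem_image.2 ⟨_, hw, rfl⟩
  calc (computedLeaves G C₂).card ^ 2
      ≤ _ := card_sq_le_mul_card_image (computedLeaves G C₂) G.leftOperand G.rightOperand
          Sigma.fst ?_
    _ ≤ _ := Nat.mul_le_mul (Nat.mul_le_mul hA hB) hC
    _ = _ := by ring
  -- The left operand gives lo and k of the first leaf, the right operand gives hi and lo + k of the
  -- second; being in a common tree supplies the missing coordinate of each.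
  intro t t' s s' h1 h2 h3 h4
  have e1 := leftOperand_eq h3
  have e2 := rightOperand_eq h4
  have e3 : t.1.lo = t'.1.lo := by rw [h1]
  have e4 : t.1.hi = t'.1.hi := by rw [h1]
  have e5 : s.1.lo = s'.1.lo := by rw [h2]
  have e6 : s.1.hi = s'.1.hi := by rw [h2]
  exact ⟨LeafIndex.ext_val (Subproblem.ext_lo_hi (by omega) (by omega)) (by omega),
    LeafIndex.ext_val (Subproblem.ext_lo_hi (by omega) (by omega)) (by omega)⟩

/-! ### Segment length and the numerical bound -/

/-- The integer square root costs nothing here: y < 3M would give M + y ≤ 4M - 1, and the gap 64M³ -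
(4M - 1)³, of order 48M², exceeds the rounding error 2X + 1 ≤ 16M² + 1 of the square root X. -/
theorem three_mul_le_of_sqrt_sq_le {M y : ℕ} (h : Nat.sqrt (64 * M ^ 3) ^ 2 ≤ (M + y) ^ 3) :
    3 * M ≤ y := by
  by_contra! hy
  obtain ⟨m, rfl⟩ : ∃ m, M = m + 1 := ⟨M - 1, by omega⟩
  set X := Nat.sqrt (64 * (m + 1) ^ 3) with hX
  have h1 : 64 * (m + 1) ^ 3 < (X + 1) ^ 2 :=
    Nat.lt_succ_sqrt' _
  have h2 : X ≤ 8 * (m + 1) ^ 2 := by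
    refine (Nat.pow_le_pow_iff_left two_ne_zero).1 ((Nat.sqrt_le' _).trans ?_)
    nlinarith [Nat.pow_le_pow_right (n := m + 1) (by omega) (show 3 ≤ 4 by norm_num)]
  have h3 : (m + 1 + y) ^ 3 ≤ (4 * m + 3) ^ 3 := Nat.pow_le_pow_left (by omega) 3
  nlinarith

/-- A part of a schedule computing many leaves needs many transfers or computations of roots. -/
theorem ValidRun.segments {M B : ℕ} {C : List (PebbleAction G.Vertex)}
    {σ τ : MemState G.Vertex} (h : ValidRun G M B C σ τ) (k : ℕ) :
    ∀ C₁ C₂, C = C₁ ++ C₂ → k * Nat.sqrt (64 * M ^ 3) ≤ leafCount G C₂ →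
      k * (3 * M) ≤ B * ioCount C₂ + (computedRoots G C₂).card := by
  classical
  induction k with
  | zero => simp
  | succ k ih =>
    rintro C₁ C₂ rfl hk
    -- `D` is one full segment. The induction runs over suffixes of a fixed `C` because the segment
    -- bound uses what precedes and follows the segment in the whole schedule.
    obtain ⟨D, E, rfl, hD⟩ := List.exists_append_countP_eq _ C₂ (Nat.sqrt (64 * M ^ 3))
      (le_trans (by rw [add_mul]; omega) hk)
    have hDE : leafCount G (D ++ E) = leafCount G D + leafCount G E := List.countP_append
    have hD' : leafCount G D = Nat.sqrt (64 * M ^ 3) := hD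
    have h1 := h.sq_leafCount_le
    rw [hD'] at h1
    have h2 := three_mul_le_of_sqrt_sq_le h1
    have h3 := ih (C₁ ++ D) E (by simp) (by rw [add_mul] at hk; omega)
    have hnd := h.nodup
    rw [computedValues_append, List.nodup_append'] at hnd
    rw [card_computedRoots_append hnd.2.1, ioCount_append, mul_add, add_mul]
    omega

theorem ValidRun.exists_le {M B : ℕ} {C : List (PebbleAction G.Vertex)}
    {σ τ : MemState G.Vertex} (h : ValidRun G M B C σ τ) :
    ∃ L : ℕ, n ^ 3 ≤ 6 * L + n ∧
      2 * (L / Nat.sqrt (64 * M ^ 3) * (3 * M)) ≤ 2 * (B * ioCount C) + n * (n + 1) := by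
  obtain ⟨S, hS⟩ := exists_finset_leafIndex n
  refine ⟨S.card, hS, ?_⟩
  have h1 : S.card ≤ leafCount G C := by
    rw [← card_computedLeaves h.nodup]
    exact Finset.card_le_card fun t _ => mem_computedLeaves.2 (h.node_mem_computedValues _ _)
  have h2 := h.segments (S.card / Nat.sqrt (64 * M ^ 3)) [] C rfl
    ((Nat.div_mul_le_self _ _).trans h1)
  have h3 := two_mul_card_subproblem_le (computedRoots G C)
  omega

/-- With s = √M and X ≤ 8s³, the L leaves contribute 3M · L/(8s³) = 6L/(16s). Rounding down the
number of segments loses at most one segment, hence the term 3M. -/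
theorem ValidRun.main_bound {M B : ℕ} {C : List (PebbleAction G.Vertex)}
    {σ τ : MemState G.Vertex} (h : ValidRun G M B C σ τ) (hM : 1 ≤ M) :
    ((n : ℝ) ^ 3 - (n : ℝ)) / (16 * Real.sqrt (M : ℝ)) - (n : ℝ) * ((n : ℝ) + 1) / 2
      - 3 * (M : ℝ) ≤ B * ioCount C := by
  obtain ⟨L, hL, hle⟩ := h.exists_le
  set X := Nat.sqrt (64 * M ^ 3) with hX
  have hXpos : 0 < X := Nat.sqrt_pos.2 (by positivity)
  set s := Real.sqrt (M : ℝ) with hs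
  have hM0 : (1 : ℝ) ≤ M := by exact_mod_cast hM
  have hs0 : 0 < s := Real.sqrt_pos.2 (by linarith)
  have hss : s * s = M := Real.mul_self_sqrt (by linarith)
  have hXs : (X : ℝ) ≤ 8 * s ^ 3 := by
    refine (sq_le_sq₀ (by positivity) (by positivity)).1 ?_
    have h1 : ((X ^ 2 : ℕ) : ℝ) ≤ ((64 * M ^ 3 : ℕ) : ℝ) := by
      exact_mod_cast (by rw [hX, sq]; exact Nat.sqrt_le _)
    push_cast at h1
    rw [← hss] at h1
    calc (X : ℝ) ^ 2 ≤ _ := h1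
      _ = _ := by ring
  have hdiv : (L : ℝ) / (8 * s ^ 3) ≤ (L / X : ℕ) + 1 := by
    have h1 : L < X * (L / X + 1) := Nat.lt_mul_div_succ L hXpos
    have h2 : (L : ℝ) ≤ X * ((L / X : ℕ) + 1) := by exact_mod_cast h1.le
    rw [div_le_iff₀ (by positivity)]
    calc (L : ℝ) ≤ X * ((L / X : ℕ) + 1) := h2
      _ ≤ 8 * s ^ 3 * ((L / X : ℕ) + 1) := by gcongr
      _ = _ := by ring
  have hLr : (n : ℝ) ^ 3 ≤ 6 * L + n := by exact_mod_cast hL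
  have hler : 2 * (((L / X : ℕ) : ℝ) * (3 * M)) ≤ 2 * (B * ioCount C) + n * (n + 1) := by
    exact_mod_cast hle
  have h1 : ((n : ℝ) ^ 3 - n) / (16 * s) ≤ (L : ℝ) / (8 * s ^ 3) * (3 * M) := by
    have : (L : ℝ) / (8 * s ^ 3) * (3 * M) = 6 * L / (16 * s) := by
      rw [← hss]
      field_simp
      ring
    rw [this]
    gcongr
    linarith
  have h2 : (L : ℝ) / (8 * s ^ 3) * (3 * M) ≤ ((L / X : ℕ) + 1) * (3 * M) := by gcongr
  linarith

theorem io_lower_bound {M B : ℕ} (hn : 2 ≤ n) (hM : 1 ≤ M) {C : List (PebbleAction G.Vertex)}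
    (hC : IsSchedule G.graph M B C) (hnd : NoRecomputation C) :
    max (((n : ℝ) ^ 3 - (n : ℝ)) / (16 * Real.sqrt (M : ℝ))
      - (n : ℝ) * ((n : ℝ) + 1) / 2 - 3 * (M : ℝ)) (n : ℝ) ≤ B * ioCount C := by
  obtain ⟨σ, τ, h1, h2, h3, h4⟩ := hC
  have h : ValidRun G M B C σ τ := ⟨h1, h2, h3, h4, hnd⟩
  exact max_le (h.main_bound hM) (by exact_mod_cast h.le_mul_ioCount hn)

end DPCdag

/-- When the cache is small, the cubic term dominates. -/
theorem cubic_div_sqrt_le {n M : ℕ} (hn : 2 ≤ n) (hM : 1 ≤ M)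
    (h : (M : ℝ) ≤ 1 / 1024 * (n : ℝ) ^ 2) :
    1 / 64 * ((n : ℝ) ^ 3 / Real.sqrt M) ≤
      ((n : ℝ) ^ 3 - (n : ℝ)) / (16 * Real.sqrt (M : ℝ))
        - (n : ℝ) * ((n : ℝ) + 1) / 2 - 3 * (M : ℝ) := by
  set s := Real.sqrt (M : ℝ) with hs
  have hM0 : (1 : ℝ) ≤ M := by exact_mod_cast hM
  have hn0 : (2 : ℝ) ≤ n := by exact_mod_cast hn
  have hs0 : 0 < s := Real.sqrt_pos.2 (by linarith)
  have hss : s * s = M := Real.mul_self_sqrt (by linarith)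
  -- The constant 1/1024 is 1/32².
  have hsn : s ≤ n / 32 := by
    refine (sq_le_sq₀ (by positivity) (by positivity)).1 ?_
    rw [sq, hss]
    linarith
  rw [← hss]
  have h1 : (n : ℝ) ≤ n ^ 3 / 4 := by nlinarith
  have h2 : s * (n * (n + 1) / 2) ≤ n / 32 * (3 / 4 * n ^ 2) := by
    gcongr
    nlinarith
  have h3 : s * (3 * (s * s)) ≤ n / 32 * (3 * (n / 32 * (n / 32))) := by gcongr
  have h4 : (0 : ℝ) ≤ n ^ 3 := by positivity
  -- In units of n³: the main term is at least 3/64 by `h1`, and the losses are at most 3/128,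
  -- 3/32768 and 1/64.
  have key : 0 ≤ (n ^ 3 - n) / 16 - s * (n * (n + 1) / 2) - s * (3 * (s * s)) - n ^ 3 / 64 := by
    linarith
  have : (n ^ 3 - n) / (16 * s) - n * (n + 1) / 2 - 3 * (s * s) - 1 / 64 * (n ^ 3 / s)
      = ((n ^ 3 - n) / 16 - s * (n * (n + 1) / 2) - s * (3 * (s * s)) - n ^ 3 / 64) / s := by
    field_simp
  have := div_nonneg key hs0.le
  linarith

end

theorem theorem1 :
    (∀ (n M B : ℕ), 2 ≤ n → 1 ≤ M → 1 ≤ B →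
      ∀ (G : DPCdag n) (C : List (PebbleAction G.Vertex)),
        IsSchedule G.graph M B C → NoRecomputation C →
          max (((n : ℝ) ^ 3 - (n : ℝ)) / (16 * Real.sqrt (M : ℝ))
                - (n : ℝ) * ((n : ℝ) + 1) / 2 - 3 * (M : ℝ)) (n : ℝ) / (B : ℝ)
            ≤ (ioCount C : ℝ)) ∧
    (∃ c : ℝ, 0 < c ∧ ∃ K : ℝ, 0 < K ∧
      ∀ (n M B : ℕ), 2 ≤ n → 1 ≤ M → 1 ≤ B → (M : ℝ) ≤ c * (n : ℝ) ^ 2 →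
      ∀ (G : DPCdag n) (C : List (PebbleAction G.Vertex)),
        IsSchedule G.graph M B C → NoRecomputation C →
          K * ((n : ℝ) ^ 3 / (Real.sqrt (M : ℝ) * (B : ℝ))) ≤ (ioCount C : ℝ)) := by
  refine ⟨fun n M B hn hM hB G C hC hnd => ?_, 1 / 1024, by norm_num, 1 / 64, by norm_num,
    fun n M B hn hM hB hMn G C hC hnd => ?_⟩
  · rw [div_le_iff₀ (by exact_mod_cast hB), mul_comm (ioCount C : ℝ)]
    exact DPCdag.io_lower_bound hn hM hC hnd
  · have hB' : (0 : ℝ) < B := by exact_mod_cast hB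
    rw [← div_div, ← mul_div_assoc, div_le_iff₀ hB', mul_comm (ioCount C : ℝ)]
    exact (cubic_div_sqrt_le hn hM hMn).trans
      ((le_max_left _ _).trans (DPCdag.io_lower_bound hn hM hC hnd))
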